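/- For a distribution function $F$ let $F^{-1}(u)=\inf\{x: F(x)\ge u\}$, $0<u<1$. Let $F_m$ be the empirical distribution function of an i.i.d. sample of size $m$ from $F$, and put $$D_m=\sup_x|F_m(x)-F(x)|,\qquad T_m=\int_0^1|F_m^{-1}(u)-F^{-1}(u)|^2\,du ,$$ with medians $\mathrm{med}_F(D_m)$ and $\mathrm{med}_F(T_m)$ (where the median of a random variable $Y$ is $\inf\{t: P(Y\le t)\ge 1/2\}$). A distribution function $G$ is called empirically indistinguishable from $F$ if, for $m=10^6$, $$\sup_x|G(x)-F(x)|\le \mathrm{med}_F(D_m)\quad\text{and}\quad \int_0^1|G^{-1}(u)-F^{-1}(u)|^2\,du\le \mathrm{med}_F(T_m).$$ **Proposition.** For each integer $n\ge 2$ there exist an $n$-dimensional copula $C$ and a value $a>0$ such that, if $X_1,\dots,X_n$ are random variables, each uniformly distributed on $[-a,a]$, with joint distribution function $P(X_1\le x_1,\dots,X_n\le x_n)=C(H(x_1),\dots,H(x_n))$, where $H$ is the distribution function of the uniform distribution on $[-a,a]$, then the distribution function of $X_1+\dots+X_n$ is empirically indistinguishable from that of the standard normal distribution $\mathcal N(0,1)$.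 -/

import Mathlib

open MeasureTheory ProbabilityTheory
open scoped ENNReal

noncomputable section

/-- The uniform distribution on the interval `[a, b]` (normalized Lebesgue measure; `a < b`). -/
def uniformLaw (a b : ℝ) : Measure ℝ :=
  ProbabilityTheory.cond volume (Set.Icc a b)

/-- `C` is an `n`-dimensional copula: on the cube `[0,1]^n` it coincides with the joint
distribution function of a random vector all of whose margins are uniform on `[0,1]`.
(Values of `C` outside the cube are irrelevant.) -/
def IsCopula {n : ℕ} (C : (Fin n → ℝ) → ℝ) : Prop :=
  ∃ ν : Measure (Fin n → ℝ), IsProbabilityMeasure ν ∧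
    (∀ i, ν.map (fun x => x i) = uniformLaw 0 1) ∧
    ∀ u : Fin n → ℝ, (∀ i, u i ∈ Set.Icc (0 : ℝ) 1) → C u = ν.real {x | ∀ i, x i ≤ u i}

/-- `μ` is a joint law on `ℝ^n` with `i`-th margin `F i` and copula `C`, that is,
`P(X₁ ≤ x₁, …, Xₙ ≤ xₙ) = C(F₁(x₁), …, Fₙ(xₙ))`. -/
def IsJointLaw {n : ℕ} (C : (Fin n → ℝ) → ℝ) (F : Fin n → Measure ℝ)
    (μ : Measure (Fin n → ℝ)) : Prop :=
  IsProbabilityMeasure μ ∧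
    (∀ i, μ.map (fun x => x i) = F i) ∧
    ∀ x : Fin n → ℝ, μ.real {y | ∀ i, y i ≤ x i} = C (fun i => cdf (F i) (x i))

/-- The generalized inverse (quantile function) `F⁻¹(u) = inf {x | u ≤ F x}`, for `0 < u < 1`. -/
def quantileFn (F : ℝ → ℝ) (u : ℝ) : ℝ := sInf {x : ℝ | u ≤ F x}

/-- The empirical distribution function of the sample `x₁, …, x_m`. -/
def empiricalCDF {m : ℕ} (x : Fin m → ℝ) (t : ℝ) : ℝ :=
  ((Finset.univ.filter fun i => x i ≤ t).card : ℝ) / m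

/-- The Kolmogorov-Smirnov distance `sup_t |G(t) - F(t)|`. -/
def ksDist (G F : ℝ → ℝ) : ℝ≥0∞ := ⨆ t : ℝ, ENNReal.ofReal |G t - F t|

/-- The squared `L²`-Wasserstein distance `∫₀¹ |G⁻¹(u) - F⁻¹(u)|² du`. -/
def l2WassersteinSq (G F : ℝ → ℝ) : ℝ≥0∞ :=
  ∫⁻ u in Set.Ioo (0 : ℝ) 1, ENNReal.ofReal (|quantileFn G u - quantileFn F u| ^ 2)

/-- The median `inf {t | P(T ≤ t) ≥ 1/2}` of a nonnegative random variable `T` (the smallest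
median, should there be several). -/
def medianOf {Ω : Type*} [MeasurableSpace Ω] (P : Measure Ω) (T : Ω → ℝ≥0∞) : ℝ≥0∞ :=
  sInf {t : ℝ≥0∞ | 1 / 2 ≤ P {ω | T ω ≤ t}}

/-- The law of an i.i.d. sample of size `m` from the distribution `F`. -/
def sampleLaw (F : Measure ℝ) (m : ℕ) : Measure (Fin m → ℝ) := Measure.pi fun _ => F

/-- The median of `D_m = sup_t |F_m(t) - F(t)|`, with `F_m` the empirical distribution function
of an i.i.d. sample of size `m` from `F`. -/
def medKS (F : Measure ℝ) (m : ℕ) : ℝ≥0∞ :=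
  medianOf (sampleLaw F m) fun x => ksDist (empiricalCDF x) (cdf F)

/-- The median of `T_m = ∫₀¹ |F_m⁻¹(u) - F⁻¹(u)|² du`, with `F_m` the empirical distribution
function of an i.i.d. sample of size `m` from `F`. -/
def medL2W (F : Measure ℝ) (m : ℕ) : ℝ≥0∞ :=
  medianOf (sampleLaw F m) fun x => l2WassersteinSq (empiricalCDF x) (cdf F)

/-- `G` is empirically KS-indistinguishable from `F` with a sample size of `m = 10^6`. -/
def EmpiricallyKSIndistinguishable (G F : Measure ℝ) : Prop :=
  ksDist (cdf G) (cdf F) ≤ medKS F (10 ^ 6)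

/-- `G` is empirically `L²`-`W`-indistinguishable from `F` with a sample size of `m = 10^6`. -/
def EmpiricallyL2WIndistinguishable (G F : Measure ℝ) : Prop :=
  l2WassersteinSq (cdf G) (cdf F) ≤ medL2W F (10 ^ 6)

/-- `G` is empirically indistinguishable from `F`. -/
def EmpiricallyIndistinguishable (G F : Measure ℝ) : Prop :=
  EmpiricallyL2WIndistinguishable G F ∧ EmpiricallyKSIndistinguishable G F

end

/-!
The medians in question are positive numbers, so it suffices to make the law of the sum arbitrarily
close to `N(0,1)` in both distances, by taking `a` large.

*Positive medians* (`medKS_pos`, `medL2W_pos`). Both statistics are bounded away from zero for every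
sample: `F_m` only takes multiples of `1/m` as values, and `F_m⁻¹` is constant on `(0, 1/m]`, while
`F` is continuous and takes every value in `(0, 1)`.

*A pair of uniform variables* (`exists_uniform_coupling`). Let `W` be uniform on the circle of
circumference `4a` and `Z` an independent standard normal variable. Folding the circle onto
`[-a, a]` maps `W` and `W + Z` to variables `Y` and `X`, which are both uniform by invariance under rotation.
The folding map is 1-Lipschitz, and `X - Y = ± Z`, the sign being that of `W`, unless `W` lies
within `|Z|` of one of the two folds. Given `Z`, this has probability at most `|Z| / a`. Since `± Z`
is again standard normal, `X - Y` agrees with a standard normal variable up to an event of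
probability at most `E|Z| / a`, and up to a mean square error of at most `4 E|Z|³ / a`.

*From two to `n` variables* (`exists_jointMix`). There are `n` functions of a variable `Y` uniform
on `[-a, a]`, one of them `Y` itself, that are all uniform on `[-a, a]` and sum to zero: pairs `Y`,
`-Y` and, for odd `n`, one triple `Y`, `Y ± a`, `-(2Y ± a)`. Replacing the component `Y` by `X` gives `n`
uniform variables with sum `X - Y`.

*Comparison of distances* (`ksDist_cdf_map_le`, `l2WassersteinSq_cdf_map_le`). Any coupling bounds
both distances. For the quadratic one, `(x - y)₊²` is twice the area of the triangle
`y ≤ s ≤ t < x`; hence `E (X - Y)₊²` is twice the integral of `P(Y ≤ s, t < X)` over `s ≤ t`, and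
`P(Y ≤ s, t < X) ≥ (P(Y ≤ s) - P(X ≤ t))₊`, with equality for the quantile functions.

Finally, a joint law is determined by its copula and margins (`IsJointLaw.eq`), so that the sum has
the law just constructed under every law with this copula.
-/

/-! ### Lower bounds for the medians -/

/-- If a statistic is bounded below by `c` for every outcome, so is its median. -/
theorem le_medianOf {Ω : Type*} [MeasurableSpace Ω] (P : Measure Ω) (T : Ω → ℝ≥0∞) (c : ℝ≥0∞)
    (h : ∀ ω, c ≤ T ω) : c ≤ medianOf P T := by
  refine le_sInf fun t ht => ?_
  have hne : {ω | T ω ≤ t}.Nonempty := by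
    by_contra hemp
    rw [Set.not_nonempty_iff_eq_empty] at hemp
    simp [hemp] at ht
  obtain ⟨ω, hω⟩ := hne
  exact (h ω).trans hω

theorem continuous_cdf (F : Measure ℝ) [IsProbabilityMeasure F] [NullSingletonClass F] :
    Continuous (cdf F) := by
  rw [continuous_iff_continuousAt]
  intro x
  rw [(monotone_cdf F).continuousAt_iff_leftLim_eq_rightLim, StieltjesFunction.rightLim_eq]
  have h : (cdf F).measure {x} = 0 := by rw [measure_cdf]; exact measure_singleton x
  rw [StieltjesFunction.measure_singleton, ENNReal.ofReal_eq_zero] at h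
  exact le_antisymm ((monotone_cdf F).leftLim_le le_rfl) (by linarith)

theorem exists_cdf_eq (F : Measure ℝ) [IsProbabilityMeasure F] [NullSingletonClass F] {u : ℝ}
    (hu : u ∈ Set.Ioo (0 : ℝ) 1) : ∃ x, cdf F x = u :=
  mem_range_of_exists_le_of_exists_ge (continuous_cdf F)
    (((tendsto_cdf_atBot F).eventually (eventually_le_nhds hu.1)).exists)
    (((tendsto_cdf_atTop F).eventually (eventually_ge_nhds hu.2)).exists)

theorem empiricalCDF_eq_zero_or_le {m : ℕ} (x : Fin m → ℝ) (t : ℝ) :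
    empiricalCDF x t = 0 ∨ 1 / (m : ℝ) ≤ empiricalCDF x t := by
  unfold empiricalCDF
  rcases Nat.eq_zero_or_pos (Finset.univ.filter fun i => x i ≤ t).card with h | h
  · left; simp [h]
  · right
    gcongr
    exact_mod_cast h

theorem medKS_pos (F : Measure ℝ) [IsProbabilityMeasure F] [NullSingletonClass F] {m : ℕ}
    (hm : 0 < m) : 0 < medKS F m := by
  have hm' : (1 : ℝ) ≤ m := by exact_mod_cast hm
  have hc : (0 : ℝ) < 1 / (2 * m) := by positivity
  -- At a point where `F` equals `1 / (2m)`, any multiple of `1 / m` is at least `1 / (2m)` away.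
  obtain ⟨t, ht⟩ := exists_cdf_eq F (u := 1 / (2 * m))
    ⟨hc, by rw [div_lt_one (by positivity)]; linarith⟩
  refine (ENNReal.ofReal_pos.2 hc).trans_le (le_medianOf _ _ _ fun x => ?_)
  refine le_trans (ENNReal.ofReal_le_ofReal ?_)
    (le_iSup (fun t => ENNReal.ofReal |empiricalCDF x t - cdf F t|) t)
  have h2 : 1 / (m : ℝ) = 2 * (1 / (2 * m)) := by field_simp
  rw [ht]
  rcases empiricalCDF_eq_zero_or_le x t with h | h
  · rw [h, zero_sub, abs_neg]; exact le_abs_self _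
  · exact le_trans (by linarith) (le_abs_self _)

theorem bddBelow_le_cdf (F : Measure ℝ) {u : ℝ} (hu : 0 < u) : BddBelow {x | u ≤ cdf F x} := by
  obtain ⟨b, hb⟩ := ((tendsto_cdf_atBot F).eventually (eventually_lt_nhds hu)).exists
  exact ⟨b, fun x hx => le_of_lt ((monotone_cdf F).reflect_lt (hb.trans_le hx))⟩

theorem nonempty_le_cdf (F : Measure ℝ) {u : ℝ} (hu : u < 1) : {x | u ≤ cdf F x}.Nonempty :=
  ((tendsto_cdf_atTop F).eventually (eventually_ge_nhds hu)).exists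

/-- The Galois connection between a distribution function and its quantile function. -/
theorem quantileFn_le_iff (F : Measure ℝ) {u : ℝ} (hu : u ∈ Set.Ioo (0 : ℝ) 1) (x : ℝ) :
    quantileFn (cdf F) u ≤ x ↔ u ≤ cdf F x := by
  refine ⟨fun h => ?_, fun h => csInf_le (bddBelow_le_cdf F hu.1) h⟩
  -- Right continuity shows that the infimum defining the quantile is attained.
  have hgt : ∀ y, x < y → u ≤ cdf F y := fun y hy => by
    obtain ⟨z, hz, hzy⟩ := exists_lt_of_csInf_lt (nonempty_le_cdf F hu.2) (h.trans_lt hy)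
    exact hz.trans (monotone_cdf F hzy.le)
  have hc : Filter.Tendsto (cdf F) (nhdsWithin x (Set.Ioi x)) (nhds (cdf F x)) :=
    ((cdf F).right_continuous x).mono_left (nhdsWithin_mono _ Set.Ioi_subset_Ici_self)
  exact ge_of_tendsto hc (by filter_upwards [self_mem_nhdsWithin] with y hy using hgt y hy)

/-- The empirical quantile function is constant on `(0, 1/m]`, whereas `F⁻¹` takes values `≤ x₁` and
values `≥ x₂ > x₁` there on sets of length `1/(3m)`. This bounds `T_m` away from `0`. -/
theorem medL2W_pos (F : Measure ℝ) [IsProbabilityMeasure F] [NullSingletonClass F] {m : ℕ}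
    (hm : 0 < m) : 0 < medL2W F m := by
  have hm' : (1 : ℝ) ≤ m := by exact_mod_cast hm
  set d : ℝ := 1 / (3 * m) with hd
  have hd0 : 0 < d := by positivity
  have h3d : 1 / (m : ℝ) = 3 * d := by rw [hd]; field_simp
  have h3d1 : 3 * d ≤ 1 := by rw [← h3d, div_le_one (by positivity)]; exact hm'
  obtain ⟨x₁, hx₁⟩ := exists_cdf_eq F (u := d) ⟨hd0, by linarith⟩
  obtain ⟨x₂, hx₂⟩ := exists_cdf_eq F (u := 2 * d) ⟨by linarith, by linarith⟩
  have hx : x₁ < x₂ := (monotone_cdf F).reflect_lt (by rw [hx₁, hx₂]; linarith)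
  set r : ℝ := (x₂ - x₁) / 2 with hr
  have hr0 : 0 < r := by rw [hr]; linarith
  refine lt_of_lt_of_le (b := ENNReal.ofReal (r ^ 2) * ENNReal.ofReal d) ?_
    (le_medianOf _ _ _ fun x => ?_)
  · exact ENNReal.mul_pos (ENNReal.ofReal_pos.2 (by positivity)).ne' (ENNReal.ofReal_pos.2 hd0).ne'
  obtain ⟨c, hc⟩ : ∃ c, ∀ u ∈ Set.Ioo 0 (3 * d), quantileFn (empiricalCDF x) u = c := by
    refine ⟨quantileFn (empiricalCDF x) d, fun u hu => ?_⟩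
    unfold quantileFn
    congr 1
    ext t
    simp only [Set.mem_ofPred_eq]
    rcases empiricalCDF_eq_zero_or_le x t with h | h
    · rw [h]; constructor <;> intro h' <;> linarith [hu.1]
    · rw [h3d] at h; constructor <;> intro h' <;> linarith [hu.2]
  have key : ∀ p q : ℝ, q - p = d → 0 ≤ p → q ≤ 3 * d →
      (∀ u ∈ Set.Ioo p q, r ≤ |c - quantileFn (cdf F) u|) →
      ENNReal.ofReal (r ^ 2) * ENNReal.ofReal d ≤ l2WassersteinSq (empiricalCDF x) (cdf F) := by
    intro p q hpq hp hq h
    have hvol : ENNReal.ofReal d = volume (Set.Ioo p q) := by rw [Real.volume_Ioo, hpq]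
    rw [hvol, ← setLIntegral_const]
    refine le_trans (setLIntegral_mono' measurableSet_Ioo fun u hu => ?_)
      (lintegral_mono_set (Set.Ioo_subset_Ioo hp (by linarith)))
    rw [hc u ⟨by linarith [hu.1], by linarith [hu.2]⟩]
    exact ENNReal.ofReal_le_ofReal (by gcongr; exact h u hu)
  rcases le_total c (x₁ + r) with hcr | hcr
  · refine key (2 * d) (3 * d) (by ring) (by linarith) le_rfl fun u hu => ?_
    have h1 : x₂ ≤ quantileFn (cdf F) u := by
      by_contra! hlt
      have := (quantileFn_le_iff F ⟨by linarith [hu.1], by linarith [hu.2]⟩ _).1 hlt.le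
      linarith [hu.1]
    rw [abs_sub_comm]
    exact le_trans (by linarith) (le_abs_self _)
  · refine key 0 d (by ring) le_rfl (by linarith) fun u hu => ?_
    have h1 : quantileFn (cdf F) u ≤ x₁ :=
      (quantileFn_le_iff F ⟨hu.1, by linarith [hu.2]⟩ _).2 (by rw [hx₁]; exact hu.2.le)
    exact le_trans (by linarith) (le_abs_self _)

/-! ### Couplings bound the two distances -/

/-- The square of the positive part of `x - y` as the area of the triangle `y ≤ s ≤ t < x`. -/
theorem ofReal_sub_sq_eq_two_mul_volume (x y : ℝ) :
    ENNReal.ofReal (x - y) ^ 2 =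
      2 * (volume.restrict {p : ℝ × ℝ | p.1 ≤ p.2}) {p | y ≤ p.1 ∧ p.2 < x} := by
  have hms : MeasurableSet {p : ℝ × ℝ | y ≤ p.1 ∧ p.2 < x} :=
    (measurableSet_le measurable_const measurable_fst).inter
      (measurableSet_lt measurable_snd measurable_const)
  have hms' : MeasurableSet {p : ℝ × ℝ | p.1 ≤ p.2} :=
    measurableSet_le measurable_fst measurable_snd
  rw [Measure.restrict_apply hms, Measure.volume_eq_prod, Measure.prod_apply (hms.inter hms')]
  have hsec : ∀ s : ℝ, volume (Prod.mk s ⁻¹' ({p : ℝ × ℝ | y ≤ p.1 ∧ p.2 < x} ∩ {p | p.1 ≤ p.2})) =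
      (Set.Ici y).indicator (fun s => ENNReal.ofReal (x - s)) s := by
    intro s
    by_cases hs : y ≤ s
    · rw [Set.indicator_of_mem (Set.mem_Ici.2 hs), ← Real.volume_Ico]
      congr 1
      ext t
      simp only [Set.mem_preimage, Set.mem_inter_iff, Set.mem_ofPred_eq, Set.mem_Ico]
      tauto
    · rw [Set.indicator_of_notMem (by simpa using hs)]
      convert! measure_empty (μ := (volume : Measure ℝ))
      ext t
      simp [hs]
  simp_rw [hsec]
  rw [lintegral_indicator measurableSet_Ici]
  rcases le_total x y with h | h
  · have : ∫⁻ s in Set.Ici y, ENNReal.ofReal (x - s) = 0 := by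
      rw [setLIntegral_congr_fun (g := 0) measurableSet_Ici
        fun s hs => ENNReal.ofReal_of_nonpos (by linarith [Set.mem_Ici.1 hs])]
      simp
    rw [this, ENNReal.ofReal_of_nonpos (by linarith)]
    simp
  · have h1 : ∫⁻ s in Set.Ici y, ENNReal.ofReal (x - s) =
        ∫⁻ s in Set.Icc y x, ENNReal.ofReal (x - s) := by
      rw [← Set.Icc_union_Ioi_eq_Ici h, lintegral_union measurableSet_Ioi
        (Set.disjoint_left.2 fun s hs hs' => not_lt.2 hs.2 hs')]
      have h0 : ∫⁻ s in Set.Ioi x, ENNReal.ofReal (x - s) = 0 := by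
        rw [setLIntegral_congr_fun (g := 0) measurableSet_Ioi
          fun s hs => ENNReal.ofReal_of_nonpos (by linarith [Set.mem_Ioi.1 hs])]
        simp
      rw [h0, add_zero]
    have h2 : ∫⁻ s in Set.Icc y x, ENNReal.ofReal (x - s) =
        ENNReal.ofReal (∫ s in Set.Icc y x, (x - s)) := by
      rw [ofReal_integral_eq_lintegral_ofReal]
      · exact (continuous_const.sub continuous_id).integrableOn_Icc
      · filter_upwards [ae_restrict_mem measurableSet_Icc] with s hs
        simpa using hs.2
    have h3 : ∫ s in Set.Icc y x, (x - s) = (x - y) ^ 2 / 2 := by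
      rw [integral_Icc_eq_integral_Ioc, ← intervalIntegral.integral_of_le h,
        intervalIntegral.integral_comp_sub_left (fun s => s) x, integral_id]
      ring
    rw [h1, h2, h3, ← ENNReal.ofReal_pow (by linarith),
      show (2 : ℝ≥0∞) = ENNReal.ofReal 2 by simp, ← ENNReal.ofReal_mul (by norm_num)]
    congr 1
    ring

theorem lintegral_ofReal_sub_sq {Ω : Type*} [MeasurableSpace Ω] (P : Measure Ω) [SFinite P]
    {X Y : Ω → ℝ} (hX : AEMeasurable X P) (hY : AEMeasurable Y P) :
    ∫⁻ ω, ENNReal.ofReal (X ω - Y ω) ^ 2 ∂P =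
      2 * ∫⁻ p in {p : ℝ × ℝ | p.1 ≤ p.2}, P {ω | Y ω ≤ p.1 ∧ p.2 < X ω} := by
  wlog h : Measurable X ∧ Measurable Y generalizing X Y
  · rw [lintegral_congr_ae (g := fun ω => ENNReal.ofReal (hX.mk X ω - hY.mk Y ω) ^ 2),
      this hX.measurable_mk.aemeasurable hY.measurable_mk.aemeasurable
        ⟨hX.measurable_mk, hY.measurable_mk⟩]
    · congr 1
      refine lintegral_congr fun p => measure_congr (Filter.eventuallyEq_set.2 ?_)
      filter_upwards [hX.ae_eq_mk, hY.ae_eq_mk] with ω h1 h2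
      simp only [h1, h2]
    · filter_upwards [hX.ae_eq_mk, hY.ae_eq_mk] with ω h1 h2
      rw [h1, h2]
  obtain ⟨hX', hY'⟩ := h
  simp_rw [ofReal_sub_sq_eq_two_mul_volume]
  have hms : MeasurableSet {q : Ω × (ℝ × ℝ) | Y q.1 ≤ q.2.1 ∧ q.2.2 < X q.1} :=
    (measurableSet_le (hY'.comp measurable_fst) (measurable_fst.comp measurable_snd)).inter
      (measurableSet_lt (measurable_snd.comp measurable_snd) (hX'.comp measurable_fst))
  rw [lintegral_const_mul' _ _ (by simp)]
  congr 1
  exact (Measure.prod_apply hms).symm.trans (Measure.prod_apply_symm hms)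

theorem ofReal_abs_sub_sq (x y : ℝ) :
    ENNReal.ofReal (|x - y| ^ 2) = ENNReal.ofReal (x - y) ^ 2 + ENNReal.ofReal (y - x) ^ 2 := by
  rcases le_total x y with h | h
  · rw [ENNReal.ofReal_of_nonpos (sub_nonpos.2 h), abs_sub_comm, abs_of_nonneg (sub_nonneg.2 h),
      ENNReal.ofReal_pow (sub_nonneg.2 h)]
    simp
  · rw [ENNReal.ofReal_of_nonpos (p := y - x) (sub_nonpos.2 h), abs_of_nonneg (sub_nonneg.2 h),
      ENNReal.ofReal_pow (sub_nonneg.2 h)]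
    simp

theorem aemeasurable_quantileFn_cdf (F : Measure ℝ) :
    AEMeasurable (quantileFn (cdf F)) (volume.restrict (Set.Ioo 0 1)) :=
  aemeasurable_restrict_of_monotoneOn measurableSet_Ioo fun _ hu _ hv huv =>
    (quantileFn_le_iff F hu _).2 (huv.trans ((quantileFn_le_iff F hv _).1 le_rfl))

/-- Among all couplings, the pair of quantile functions has the least probability of the
event `Y ≤ s ≤ t < X`. -/
theorem lintegral_quantileFn_ofReal_sub_sq_le {Ω : Type*} [MeasurableSpace Ω] (P : Measure Ω)
    [IsProbabilityMeasure P] {X Y : Ω → ℝ} (hX : Measurable X) (hY : Measurable Y) :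
    ∫⁻ u in Set.Ioo (0 : ℝ) 1,
        ENNReal.ofReal (quantileFn (cdf (P.map X)) u - quantileFn (cdf (P.map Y)) u) ^ 2 ≤
      ∫⁻ ω, ENNReal.ofReal (X ω - Y ω) ^ 2 ∂P := by
  have := Measure.isProbabilityMeasure_map (μ := P) hX.aemeasurable
  have := Measure.isProbabilityMeasure_map (μ := P) hY.aemeasurable
  rw [lintegral_ofReal_sub_sq _ (aemeasurable_quantileFn_cdf _) (aemeasurable_quantileFn_cdf _),
    lintegral_ofReal_sub_sq _ hX.aemeasurable hY.aemeasurable]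
  gcongr with p
  calc (volume.restrict (Set.Ioo (0 : ℝ) 1))
        {u | quantileFn (cdf (P.map Y)) u ≤ p.1 ∧ p.2 < quantileFn (cdf (P.map X)) u}
      ≤ volume (Set.Ioc (cdf (P.map X) p.2) (cdf (P.map Y) p.1)) := by
        rw [Measure.restrict_apply' measurableSet_Ioo]
        refine measure_mono ?_
        rintro u ⟨⟨h1, h2⟩, hu⟩
        rw [quantileFn_le_iff _ hu] at h1
        rw [← not_le, quantileFn_le_iff _ hu, not_le] at h2
        exact ⟨h2, h1⟩
    _ = P (Y ⁻¹' Set.Iic p.1) - P (X ⁻¹' Set.Iic p.2) := by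
        rw [Real.volume_Ioc, ENNReal.ofReal_sub _ (cdf_nonneg _ _), ofReal_cdf, ofReal_cdf,
          Measure.map_apply hX measurableSet_Iic, Measure.map_apply hY measurableSet_Iic]
    _ ≤ P (Y ⁻¹' Set.Iic p.1 \ X ⁻¹' Set.Iic p.2) := le_measure_sdiff
    _ ≤ P {ω | Y ω ≤ p.1 ∧ p.2 < X ω} := measure_mono fun ω hω => ⟨hω.1, not_le.1 hω.2⟩

/-- The monotone coupling is optimal for the quadratic cost. -/
theorem l2WassersteinSq_cdf_map_le {Ω : Type*} [MeasurableSpace Ω] (P : Measure Ω)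
    [IsProbabilityMeasure P] {X Y : Ω → ℝ} (hX : Measurable X) (hY : Measurable Y) :
    l2WassersteinSq (cdf (P.map X)) (cdf (P.map Y)) ≤
      ∫⁻ ω, ENNReal.ofReal (|X ω - Y ω| ^ 2) ∂P := by
  unfold l2WassersteinSq
  simp_rw [ofReal_abs_sub_sq]
  have hQX := aemeasurable_quantileFn_cdf (P.map X)
  have hQY := aemeasurable_quantileFn_cdf (P.map Y)
  rw [lintegral_add_left' (by fun_prop), lintegral_add_left (by fun_prop)]
  exact add_le_add (lintegral_quantileFn_ofReal_sub_sq_le P hX hY)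
    (lintegral_quantileFn_ofReal_sub_sq_le P hY hX)

theorem ksDist_cdf_map_le {Ω : Type*} [MeasurableSpace Ω] (P : Measure Ω)
    [IsProbabilityMeasure P] {X Y : Ω → ℝ} (hX : Measurable X) (hY : Measurable Y) :
    ksDist (cdf (P.map X)) (cdf (P.map Y)) ≤ P {ω | X ω ≠ Y ω} := by
  have := Measure.isProbabilityMeasure_map (μ := P) hX.aemeasurable
  have := Measure.isProbabilityMeasure_map (μ := P) hY.aemeasurable
  refine iSup_le fun t => ?_
  rw [← ofReal_measureReal (μ := P) (s := {ω | X ω ≠ Y ω})]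
  refine ENNReal.ofReal_le_ofReal ?_
  have key : ∀ {U V : Ω → ℝ}, P.real (U ⁻¹' Set.Iic t) ≤
      P.real (V ⁻¹' Set.Iic t) + P.real {ω | U ω ≠ V ω} := fun {U V} => by
    refine (measureReal_mono ?_).trans (measureReal_union_le _ _)
    intro ω hω
    by_cases h : U ω = V ω
    · left; simpa [← h] using hω
    · right; exact h
  rw [cdf_eq_real, cdf_eq_real, map_measureReal_apply hX measurableSet_Iic,
    map_measureReal_apply hY measurableSet_Iic, abs_sub_le_iff]
  have h1 := key (U := X) (V := Y)
  have h2 := key (U := Y) (V := X)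
  simp_rw [ne_comm (a := Y _)] at h2
  constructor <;> linarith

/-! ### Joint mixability of uniform distributions -/

theorem uniformLaw_eq_smul {a b : ℝ} (hab : a < b) :
    uniformLaw a b = ENNReal.ofReal (b - a)⁻¹ • volume.restrict (Set.Icc a b) := by
  unfold uniformLaw ProbabilityTheory.cond
  rw [Real.volume_Icc, ENNReal.ofReal_inv_of_pos (sub_pos.2 hab)]

theorem isProbabilityMeasure_uniformLaw {a b : ℝ} (hab : a < b) :
    IsProbabilityMeasure (uniformLaw a b) := by
  refine cond_isProbabilityMeasure_of_finite ?_ ?_ <;> simp [hab]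

theorem map_affine_restrict {c d : ℝ} (hc : c ≠ 0) {S S' : Set ℝ} (hS' : MeasurableSet S')
    (h : ∀ x, x ∈ S ↔ c * x + d ∈ S') :
    (volume.restrict S).map (fun x => c * x + d) = ENNReal.ofReal |c⁻¹| • volume.restrict S' := by
  have hpre : S = (fun x => c * x + d) ⁻¹' S' := by ext x; exact h x
  have hmap : (volume : Measure ℝ).map (fun x => c * x + d) = ENNReal.ofReal |c⁻¹| • volume := by
    have : (fun x : ℝ => c * x + d) = (fun x => x + d) ∘ (fun x => c * x) := rfl
    rw [this, ← Measure.map_map (by fun_prop) (by fun_prop), Real.map_volume_mul_left hc,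
      Measure.map_smul, map_add_right_eq_self]
  rw [hpre, ← Measure.restrict_map (by fun_prop) hS', hmap, Measure.restrict_smul]

theorem restrict_Icc_eq_add {p q r : ℝ} (hpq : p ≤ q) (hqr : q ≤ r) :
    (volume : Measure ℝ).restrict (Set.Icc p r) =
      volume.restrict (Set.Ioo p q) + volume.restrict (Set.Ioo q r) := by
  rw [← Measure.restrict_congr_set Ioc_ae_eq_Icc, ← Set.Ioc_union_Ioc_eq_Ioc hpq hqr,
    Measure.restrict_union (Set.Ioc_disjoint_Ioc_of_le le_rfl) measurableSet_Ioc,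
    Measure.restrict_congr_set Ioo_ae_eq_Ioc, Measure.restrict_congr_set Ioo_ae_eq_Ioc]

/-- The image of Lebesgue measure on `[p, r]` under a map that is affine on `(p, q)` and
on `(q, r)`. -/
theorem map_restrict_Icc_of_piecewise_affine {f : ℝ → ℝ} (hf : Measurable f) {p q r : ℝ}
    (hpq : p ≤ q) (hqr : q ≤ r) {c₁ d₁ c₂ d₂ : ℝ} (hc₁ : c₁ ≠ 0) (hc₂ : c₂ ≠ 0)
    (hf₁ : ∀ x ∈ Set.Ioo p q, f x = c₁ * x + d₁) (hf₂ : ∀ x ∈ Set.Ioo q r, f x = c₂ * x + d₂)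
    {S₁ S₂ : Set ℝ} (hS₁ : MeasurableSet S₁) (hS₂ : MeasurableSet S₂)
    (h₁ : ∀ x, x ∈ Set.Ioo p q ↔ c₁ * x + d₁ ∈ S₁)
    (h₂ : ∀ x, x ∈ Set.Ioo q r ↔ c₂ * x + d₂ ∈ S₂) :
    (volume.restrict (Set.Icc p r)).map f =
      ENNReal.ofReal |c₁⁻¹| • volume.restrict S₁ + ENNReal.ofReal |c₂⁻¹| • volume.restrict S₂ := by
  rw [restrict_Icc_eq_add hpq hqr, Measure.map_add _ _ hf, ← map_affine_restrict hc₁ hS₁ h₁,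
    ← map_affine_restrict hc₂ hS₂ h₂]
  congr 1
  · exact Measure.map_congr (by
      filter_upwards [ae_restrict_mem measurableSet_Ioo] with x hx using hf₁ x hx)
  · exact Measure.map_congr (by
      filter_upwards [ae_restrict_mem measurableSet_Ioo] with x hx using hf₂ x hx)

theorem map_neg_uniformLaw {a : ℝ} (ha : 0 < a) :
    (uniformLaw (-a) a).map (fun y => -y) = uniformLaw (-a) a := by
  have h := map_affine_restrict (c := -1) (d := 0) (by norm_num)
    (S := Set.Icc (-a) a) (S' := Set.Icc (-a) a) measurableSet_Icc
    (fun x => by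
      simp only [Set.mem_Icc]
      constructor <;> rintro ⟨h1, h2⟩ <;> constructor <;> linarith)
  have hf : (fun x : ℝ => -1 * x + 0) = fun y => -y := by ext; ring
  rw [uniformLaw_eq_smul (by linarith), Measure.map_smul, ← hf, h]
  simp

/-- The half turn of the circle obtained from `[-a, a]` by joining the end points. -/
noncomputable def halfTurn (a y : ℝ) : ℝ := if y < 0 then y + a else y - a

theorem measurable_halfTurn (a : ℝ) : Measurable (halfTurn a) :=
  Measurable.ite measurableSet_Iio (by fun_prop) (by fun_prop)

theorem map_halfTurn_uniformLaw {a : ℝ} (ha : 0 < a) :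
    (uniformLaw (-a) a).map (halfTurn a) = uniformLaw (-a) a := by
  rw [uniformLaw_eq_smul (by linarith), Measure.map_smul,
    map_restrict_Icc_of_piecewise_affine (measurable_halfTurn a) (p := -a) (q := 0) (r := a)
      (c₁ := 1) (d₁ := a) (c₂ := 1) (d₂ := -a) (S₁ := Set.Ioo 0 a) (S₂ := Set.Ioo (-a) 0)
      (by linarith) ha.le one_ne_zero one_ne_zero (fun x hx => by simp [halfTurn, hx.2])
      (fun x hx => by simp [halfTurn, hx.1.le, sub_eq_add_neg]) measurableSet_Ioo measurableSet_Ioo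
      (fun x => by
        simp only [Set.mem_Ioo]
        constructor <;> rintro ⟨h1, h2⟩ <;> constructor <;> linarith)
      (fun x => by
        simp only [Set.mem_Ioo]
        constructor <;> rintro ⟨h1, h2⟩ <;> constructor <;> linarith),
    restrict_Icc_eq_add (p := -a) (q := 0) (by linarith) ha.le]
  simp [add_comm]

/-- The sum of the identity and a half turn is a doubling map, `2y ± a`: each half of `[-a, a]` is
stretched onto all of it. -/
theorem map_neg_add_halfTurn_uniformLaw {a : ℝ} (ha : 0 < a) :
    (uniformLaw (-a) a).map (fun y => -(y + halfTurn a y)) = uniformLaw (-a) a := by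
  have hm := measurable_halfTurn a
  rw [uniformLaw_eq_smul (by linarith), Measure.map_smul,
    map_restrict_Icc_of_piecewise_affine (by fun_prop) (p := -a) (q := 0) (r := a)
      (c₁ := -2) (d₁ := -a) (c₂ := -2) (d₂ := a) (S₁ := Set.Ioo (-a) a) (S₂ := Set.Ioo (-a) a)
      (by linarith) ha.le (by norm_num) (by norm_num)
      (fun x hx => by simp only [halfTurn, hx.2, if_true]; ring)
      (fun x hx => by simp only [halfTurn, not_lt.2 hx.1.le, if_false]; ring)
      measurableSet_Ioo measurableSet_Ioo
      (fun x => by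
        simp only [Set.mem_Ioo]
        constructor <;> rintro ⟨h1, h2⟩ <;> constructor <;> linarith)
      (fun x => by
        simp only [Set.mem_Ioo]
        constructor <;> rintro ⟨h1, h2⟩ <;> constructor <;> linarith),
    ← add_smul, ← ENNReal.ofReal_add (by positivity) (by positivity),
    Measure.restrict_congr_set Ioo_ae_eq_Icc]
  norm_num

/-- The uniform distribution on `[-a, a]` is jointly mixable: `n ≥ 2` copies of it, all of them
functions of one copy, can sum to zero. -/
theorem exists_jointMix {a : ℝ} (ha : 0 < a) :
    ∀ n : ℕ, 2 ≤ n → ∃ (f : Fin n → ℝ → ℝ) (i₀ : Fin n), (∀ y, f i₀ y = y) ∧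
      (∀ i, Measurable (f i)) ∧ (∀ i, (uniformLaw (-a) a).map (f i) = uniformLaw (-a) a) ∧
      ∀ y, ∑ i, f i y = 0
  | 0, h => absurd h (by norm_num)
  | 1, h => absurd h (by norm_num)
  | 2, _ => by
    refine ⟨![fun y => y, fun y => -y], 0, fun y => rfl, ?_, ?_, ?_⟩
    · rw [Fin.forall_fin_two]; exact ⟨measurable_id, measurable_neg⟩
    · rw [Fin.forall_fin_two]; exact ⟨Measure.map_id, map_neg_uniformLaw ha⟩
    · intro y; simp
  | 3, _ => by
    have hm := measurable_halfTurn a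
    refine ⟨![fun y => y, halfTurn a, fun y => -(y + halfTurn a y)], 0, fun y => rfl, ?_, ?_, ?_⟩
    · intro i; fin_cases i
      · exact measurable_id
      · exact hm
      · exact (measurable_id.add hm).neg
    · intro i; fin_cases i
      · exact Measure.map_id
      · exact map_halfTurn_uniformLaw ha
      · exact map_neg_add_halfTurn_uniformLaw ha
    · intro y; simp [Fin.sum_univ_succ]
  | n + 4, _ => by
    obtain ⟨f, i₀, h0, hm, hu, hs⟩ := exists_jointMix ha (n + 2) (by omega)
    refine ⟨Fin.cons (fun y => y) (Fin.cons (fun y => -y) f), i₀.succ.succ, ?_, ?_, ?_, ?_⟩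
    · simpa using h0
    · rw [Fin.forall_fin_succ, Fin.forall_fin_succ]
      exact ⟨measurable_id, measurable_neg, hm⟩
    · rw [Fin.forall_fin_succ, Fin.forall_fin_succ]
      exact ⟨Measure.map_id, map_neg_uniformLaw ha, hu⟩
    · intro y
      simp [Fin.sum_univ_succ (n := n + 3), Fin.sum_univ_succ (n := n + 2), hs]

/-! ### Two uniform variables with an almost normal difference -/

theorem map_prod_of_forall_map_eq {α β γ : Type*} [MeasurableSpace α] [MeasurableSpace β]
    [MeasurableSpace γ] {μ : Measure α} [IsProbabilityMeasure μ] {ν : Measure β} [SFinite ν]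
    {ρ : Measure γ} {f : α × β → γ} (hf : Measurable f)
    (h : ∀ x, ν.map (fun y => f (x, y)) = ρ) : (μ.prod ν).map f = ρ := by
  ext s hs
  have hx : ∀ x, ν (Prod.mk x ⁻¹' (f ⁻¹' s)) = ρ s := fun x => by
    rw [← h x, Measure.map_apply (by fun_prop) hs]; rfl
  rw [Measure.map_apply hf hs, Measure.prod_apply (hf hs)]
  simp [hx]

theorem map_prod_of_forall_map_eq_right {α β γ : Type*} [MeasurableSpace α] [MeasurableSpace β]
    [MeasurableSpace γ] {μ : Measure α} [SFinite μ] {ν : Measure β} [IsProbabilityMeasure ν]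
    {ρ : Measure γ} {f : α × β → γ} (hf : Measurable f)
    (h : ∀ y, μ.map (fun x => f (x, y)) = ρ) : (μ.prod ν).map f = ρ := by
  rw [← Measure.prod_swap, Measure.map_map hf measurable_swap]
  exact map_prod_of_forall_map_eq (hf.comp measurable_swap) h

theorem lintegral_ofReal_abs_pow_gaussianReal_ne_top (k : ℕ) :
    ∫⁻ z, ENNReal.ofReal (|z| ^ k) ∂(gaussianReal 0 1) ≠ ∞ :=
  ((memLp_id_gaussianReal (μ := 0) (v := 1) k).integrable_norm_pow').lintegral_lt_top.ne

theorem map_abs_sub_uniformLaw {a : ℝ} (ha : 0 < a) :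
    (uniformLaw (-(2 * a)) (2 * a)).map (fun w => |w| - a) = uniformLaw (-a) a := by
  rw [uniformLaw_eq_smul (by linarith), uniformLaw_eq_smul (by linarith), Measure.map_smul,
    map_restrict_Icc_of_piecewise_affine (by fun_prop) (p := -(2 * a)) (q := 0) (r := 2 * a)
      (c₁ := -1) (d₁ := -a) (c₂ := 1) (d₂ := -a) (S₁ := Set.Ioo (-a) a) (S₂ := Set.Ioo (-a) a)
      (by linarith) (by linarith) (by norm_num) (by norm_num)
      (fun x hx => by simp only [abs_of_neg hx.2]; ring)
      (fun x hx => by simp only [abs_of_pos hx.1]; ring)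
      measurableSet_Ioo measurableSet_Ioo
      (fun x => by
        simp only [Set.mem_Ioo]
        constructor <;> rintro ⟨h1, h2⟩ <;> constructor <;> linarith)
      (fun x => by
        simp only [Set.mem_Ioo]
        constructor <;> rintro ⟨h1, h2⟩ <;> constructor <;> linarith),
    ← add_smul, ← ENNReal.ofReal_add (by positivity) (by positivity), smul_smul,
    ← ENNReal.ofReal_mul (inv_nonneg.2 (by linarith)), Measure.restrict_congr_set Ioo_ae_eq_Icc]
  congr 2
  simp only [inv_neg, inv_one, abs_neg, abs_one, sub_neg_eq_add]
  field_simp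
  norm_num

/-- The folding map of the circle `ℝ / 4aℤ` onto `[-a, a]`, as a function on `ℝ`. The norm on the
circle is the distance to `0`, with values in `[0, 2a]`; the two folds are at `0` and `2a`. -/
noncomputable def circleFold (a w : ℝ) : ℝ := ‖(w : AddCircle (4 * a))‖ - a

theorem measurable_circleFold (a : ℝ) : Measurable (circleFold a) := by
  unfold circleFold
  exact ((continuous_norm.comp (AddCircle.continuous_mk' (4 * a))).sub continuous_const).measurable

theorem circleFold_eq_abs_sub {a w : ℝ} (ha : 0 < a) (hw : |w| ≤ 2 * a) :
    circleFold a w = |w| - a := by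
  rw [circleFold, (AddCircle.norm_coe_eq_abs_iff (4 * a) (by positivity)).2]
  rw [abs_of_pos (by positivity : 0 < 4 * a)]
  linarith

theorem abs_circleFold_add_sub_le (a w z : ℝ) : |circleFold a (w + z) - circleFold a w| ≤ |z| := by
  have h1 := abs_norm_sub_norm_le ((w + z : ℝ) : AddCircle (4 * a)) (w : AddCircle (4 * a))
  have h2 : ((w + z : ℝ) : AddCircle (4 * a)) - (w : AddCircle (4 * a)) =
      ((z : ℝ) : AddCircle (4 * a)) := by
    rw [AddCircle.coe_add]; abel
  have h3 : ‖((z : ℝ) : AddCircle (4 * a))‖ ≤ ‖z‖ := QuotientAddGroup.norm_mk_le_norm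
  rw [h2] at h1
  unfold circleFold
  rw [sub_sub_sub_cancel_right]
  exact h1.trans h3

/-- Shifting a uniformly distributed point on the circle does not change its distribution, hence
also not the distribution of its image under the folding map. -/
theorem map_circleFold_add_uniformLaw {a : ℝ} (ha : 0 < a) (z : ℝ) :
    (uniformLaw (-(2 * a)) (2 * a)).map (fun w => circleFold a (w + z)) = uniformLaw (-a) a := by
  have : Fact (0 < 4 * a) := ⟨by positivity⟩
  have hmk := AddCircle.measurePreserving_mk (4 * a) (-(2 * a))
  rw [show -(2 * a) + 4 * a = 2 * a by ring] at hmk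
  have hg : Measurable fun x : AddCircle (4 * a) => ‖x‖ - a :=
    (continuous_norm.sub continuous_const).measurable
  have hshift : ∀ z : ℝ, (volume.restrict (Set.Ioc (-(2 * a)) (2 * a))).map
      (fun w => circleFold a (w + z)) =
      (volume : Measure (AddCircle (4 * a))).map fun x => ‖x‖ - a := fun z => by
    have hadd := measurePreserving_add_right (volume : Measure (AddCircle (4 * a)))
      (z : AddCircle (4 * a))
    have hcomp : (fun w => circleFold a (w + z)) = (fun x : AddCircle (4 * a) => ‖x‖ - a) ∘
        ((fun x => x + (z : AddCircle (4 * a))) ∘ fun w : ℝ => (w : AddCircle (4 * a))) := by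
      ext w; simp [circleFold]
    rw [hcomp, ← Measure.map_map hg (hadd.comp hmk).measurable, (hadd.comp hmk).map_eq]
  rw [← map_abs_sub_uniformLaw ha, uniformLaw_eq_smul (by linarith), Measure.map_smul,
    Measure.map_smul, ← Measure.restrict_congr_set Ioc_ae_eq_Icc, hshift z, ← hshift 0]
  congr 1
  refine Measure.map_congr ?_
  filter_upwards [ae_restrict_mem measurableSet_Ioc] with w hw
  rw [add_zero, circleFold_eq_abs_sub ha (abs_le.2 ⟨hw.1.le, hw.2⟩)]

/-- `z` with the sign of `w`: the increment that the folding map makes of a shift by `z` at `w`. -/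
noncomputable def foldedIncrement (w z : ℝ) : ℝ := if 0 ≤ w then z else -z

theorem abs_foldedIncrement (w z : ℝ) : |foldedIncrement w z| = |z| := by
  unfold foldedIncrement; split_ifs <;> simp

theorem measurable_foldedIncrement : Measurable fun q : ℝ × ℝ => foldedIncrement q.1 q.2 :=
  Measurable.ite (measurableSet_le measurable_const measurable_fst) measurable_snd
    measurable_snd.neg

theorem map_foldedIncrement_gaussianReal (w : ℝ) (v : NNReal) :
    (gaussianReal 0 v).map (foldedIncrement w) = gaussianReal 0 v := by
  rcases le_or_gt 0 w with h | h
  · have : foldedIncrement w = id := by ext z; simp [foldedIncrement, h]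
    rw [this, Measure.map_id]
  · have : foldedIncrement w = fun z => -z := by ext z; simp [foldedIncrement, h]
    rw [this, gaussianReal_map_neg, neg_zero]

/-- As long as the shift by `z` does not pass a fold, the folding map is an isometry there. -/
theorem circleFold_add_sub_eq {a w z : ℝ} (ha : 0 < a) (h1 : |z| ≤ |w|) (h2 : |w| + |z| ≤ 2 * a) :
    circleFold a (w + z) - circleFold a w = foldedIncrement w z := by
  have hz := abs_nonneg z
  rw [circleFold_eq_abs_sub ha ((abs_add_le w z).trans h2), circleFold_eq_abs_sub ha (by linarith)]
  unfold foldedIncrement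
  have h3 := neg_abs_le z
  have h4 := le_abs_self z
  split_ifs with hw
  · rw [abs_of_nonneg hw] at h1 ⊢
    rw [abs_of_nonneg (by linarith)]; ring
  · push Not at hw
    rw [abs_of_neg hw] at h1 ⊢
    rw [abs_of_nonpos (by linarith)]; ring

/-- The points `w` that lie within distance `|z|` of one of the two folds of the circle of
circumference `4a`, namely `0` and `2a`. -/
def nearFold (a z : ℝ) : Set ℝ := {w | |w| < |z| ∨ 2 * a < |w| + |z|}

theorem measurableSet_nearFold (a : ℝ) : MeasurableSet {q : ℝ × ℝ | q.1 ∈ nearFold a q.2} := by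
  have h1 : MeasurableSet {q : ℝ × ℝ | |q.1| < |q.2|} :=
    measurableSet_lt (by fun_prop) (by fun_prop)
  have h2 : MeasurableSet {q : ℝ × ℝ | 2 * a < |q.1| + |q.2|} :=
    measurableSet_lt (by fun_prop) (by fun_prop)
  exact h1.union h2

theorem uniformLaw_nearFold_le {a : ℝ} (ha : 0 < a) (z : ℝ) :
    uniformLaw (-(2 * a)) (2 * a) (nearFold a z) ≤ ENNReal.ofReal (|z| / a) := by
  have hz := abs_nonneg z
  rw [uniformLaw_eq_smul (by linarith), Measure.smul_apply,
    Measure.restrict_apply' measurableSet_Icc, smul_eq_mul]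
  have hsub : nearFold a z ∩ Set.Icc (-(2 * a)) (2 * a) ⊆ Set.Icc (-|z|) |z| ∪
      (Set.Icc (-(2 * a)) (-(2 * a) + |z|) ∪ Set.Icc (2 * a - |z|) (2 * a)) := by
    rintro w ⟨hw | hw, h1, h2⟩
    · exact Or.inl (abs_le.1 hw.le)
    · right
      rcases le_total 0 w with h | h
      · rw [abs_of_nonneg h] at hw
        exact Or.inr ⟨by linarith, h2⟩
      · rw [abs_of_nonpos h] at hw
        exact Or.inl ⟨h1, by linarith⟩
  have hvol : volume (nearFold a z ∩ Set.Icc (-(2 * a)) (2 * a)) ≤ ENNReal.ofReal (4 * |z|) := by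
    refine (measure_mono hsub).trans ((measure_union_le _ _).trans
      ((add_le_add le_rfl (measure_union_le _ _)).trans_eq ?_))
    rw [Real.volume_Icc, Real.volume_Icc, Real.volume_Icc,
      ← ENNReal.ofReal_add (by linarith) (by linarith),
      ← ENNReal.ofReal_add (by linarith) (by linarith)]
    congr 1; ring
  refine (mul_le_mul_right hvol _).trans_eq ?_
  rw [← ENNReal.ofReal_mul (inv_nonneg.2 (by linarith))]
  congr 1
  field_simp
  norm_num

/-- Two copies of the uniform distribution on `[-a, a]`, for a large `a`, whose difference is as
close as desired to a standard normal variable. -/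
theorem exists_uniform_coupling {δ : ℝ≥0∞} (hδ : δ ≠ 0) :
    ∃ (a : ℝ) (P : Measure (ℝ × ℝ)) (X Y Z : ℝ × ℝ → ℝ), 0 < a ∧ IsProbabilityMeasure P ∧
      Measurable X ∧ Measurable Y ∧ Measurable Z ∧
      P.map X = uniformLaw (-a) a ∧ P.map Y = uniformLaw (-a) a ∧ P.map Z = gaussianReal 0 1 ∧
      P {q | X q - Y q ≠ Z q} ≤ δ ∧
      ∫⁻ q, ENNReal.ofReal (|X q - Y q - Z q| ^ 2) ∂P ≤ δ := by
  set K : ℝ≥0∞ := ∫⁻ z, ENNReal.ofReal (|z| ^ 1) ∂(gaussianReal 0 1) +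
    4 * ∫⁻ z, ENNReal.ofReal (|z| ^ 3) ∂(gaussianReal 0 1) with hK
  have hKtop : K ≠ ∞ := ENNReal.add_ne_top.2 ⟨lintegral_ofReal_abs_pow_gaussianReal_ne_top 1,
    ENNReal.mul_ne_top (by simp) (lintegral_ofReal_abs_pow_gaussianReal_ne_top 3)⟩
  obtain ⟨k, hk⟩ := ENNReal.exists_nat_mul_gt hδ hKtop
  have hk0 : k ≠ 0 := by rintro rfl; simp at hk
  obtain ⟨a, hak⟩ : ∃ a : ℝ, a = k := ⟨_, rfl⟩
  have ha : 0 < a := by rw [hak]; positivity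
  have hKa : ENNReal.ofReal a⁻¹ * K ≤ δ := by
    rw [ENNReal.ofReal_inv_of_pos ha, hak, ENNReal.ofReal_natCast, mul_comm, ← div_eq_mul_inv]
    exact ENNReal.div_le_of_le_mul' hk.le
  have := isProbabilityMeasure_uniformLaw (a := -(2 * a)) (b := 2 * a) (by linarith)
  set P : Measure (ℝ × ℝ) := (uniformLaw (-(2 * a)) (2 * a)).prod (gaussianReal 0 1) with hP
  have hfold := measurable_circleFold a
  have hX : Measurable fun q : ℝ × ℝ => circleFold a (q.1 + q.2) := by fun_prop
  have hY : Measurable fun q : ℝ × ℝ => circleFold a q.1 := by fun_prop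
  have hbad : ∀ q : ℝ × ℝ, q.1 ∉ nearFold a q.2 →
      circleFold a (q.1 + q.2) - circleFold a q.1 = foldedIncrement q.1 q.2 := fun q hq => by
    simp only [nearFold, Set.mem_ofPred_eq, not_or, not_lt] at hq
    exact circleFold_add_sub_eq ha hq.1 hq.2
  refine ⟨a, P, fun q => circleFold a (q.1 + q.2), fun q => circleFold a q.1,
    fun q => foldedIncrement q.1 q.2, ha, inferInstance, hX, hY, measurable_foldedIncrement,
    map_prod_of_forall_map_eq_right hX (map_circleFold_add_uniformLaw ha),
    map_prod_of_forall_map_eq_right hY fun _ => by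
      simpa using map_circleFold_add_uniformLaw ha 0,
    map_prod_of_forall_map_eq measurable_foldedIncrement fun w =>
      map_foldedIncrement_gaussianReal w 1, ?_, ?_⟩
  · calc P {q | circleFold a (q.1 + q.2) - circleFold a q.1 ≠ foldedIncrement q.1 q.2}
        ≤ P {q | q.1 ∈ nearFold a q.2} := measure_mono fun q hq => by
          by_contra h
          exact hq (hbad q h)
      _ = ∫⁻ z, uniformLaw (-(2 * a)) (2 * a) (nearFold a z) ∂(gaussianReal 0 1) :=
          Measure.prod_apply_symm (measurableSet_nearFold a)
      _ ≤ ∫⁻ z, ENNReal.ofReal a⁻¹ * ENNReal.ofReal (|z| ^ 1) ∂(gaussianReal 0 1) := by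
          refine lintegral_mono fun z => (uniformLaw_nearFold_le ha z).trans_eq ?_
          rw [← ENNReal.ofReal_mul (by positivity)]
          congr 1; field_simp
      _ ≤ δ := by
          rw [lintegral_const_mul' _ _ ENNReal.ofReal_ne_top]
          exact (mul_le_mul_right le_self_add _).trans hKa
  · have hpt : ∀ q : ℝ × ℝ, ENNReal.ofReal
        (|circleFold a (q.1 + q.2) - circleFold a q.1 - foldedIncrement q.1 q.2| ^ 2) ≤
        ENNReal.ofReal (4 * |q.2| ^ 2) * (nearFold a q.2).indicator 1 q.1 := fun q => by
      by_cases h : q.1 ∈ nearFold a q.2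
      · rw [Set.indicator_of_mem h, Pi.one_apply, mul_one]
        refine ENNReal.ofReal_le_ofReal ?_
        have h1 := (abs_sub (circleFold a (q.1 + q.2) - circleFold a q.1)
          (foldedIncrement q.1 q.2)).trans
          (add_le_add (abs_circleFold_add_sub_le a q.1 q.2) (abs_foldedIncrement q.1 q.2).le)
        calc _ ≤ (|q.2| + |q.2|) ^ 2 := by gcongr
          _ = _ := by ring
      · rw [hbad q h]; simp
    have hmeas : Measurable fun q : ℝ × ℝ =>
        ENNReal.ofReal (4 * |q.2| ^ 2) * (nearFold a q.2).indicator 1 q.1 := by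
      refine Measurable.mul (by fun_prop) ?_
      exact (measurable_one (α := ℝ≥0∞)).indicator (measurableSet_nearFold a)
    calc ∫⁻ q, ENNReal.ofReal
          (|circleFold a (q.1 + q.2) - circleFold a q.1 - foldedIncrement q.1 q.2| ^ 2) ∂P
        ≤ ∫⁻ q, ENNReal.ofReal (4 * |q.2| ^ 2) * (nearFold a q.2).indicator 1 q.1 ∂P :=
          lintegral_mono hpt
      _ = ∫⁻ z, ENNReal.ofReal (4 * |z| ^ 2) *
            uniformLaw (-(2 * a)) (2 * a) (nearFold a z) ∂(gaussianReal 0 1) := by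
          rw [hP, lintegral_prod_symm' _ hmeas]
          refine lintegral_congr fun z => ?_
          dsimp only
          rw [lintegral_const_mul' _ _ ENNReal.ofReal_ne_top, lintegral_indicator_one]
          exact measurable_prodMk_right (measurableSet_nearFold a)
      _ ≤ ∫⁻ z, ENNReal.ofReal a⁻¹ * (4 * ENNReal.ofReal (|z| ^ 3)) ∂(gaussianReal 0 1) := by
          refine lintegral_mono fun z =>
            (mul_le_mul_right (uniformLaw_nearFold_le ha z) _).trans_eq ?_
          rw [show (4 : ℝ≥0∞) = ENNReal.ofReal 4 by simp, ← ENNReal.ofReal_mul (by positivity),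
            ← ENNReal.ofReal_mul (by positivity), ← ENNReal.ofReal_mul (by positivity)]
          congr 1; field_simp
      _ ≤ δ := by
          rw [lintegral_const_mul' _ _ ENNReal.ofReal_ne_top, lintegral_const_mul' _ _ (by simp)]
          exact (mul_le_mul_right le_add_self _).trans hKa

/-! ### Joint laws and copulas -/

/-- A law on `ℝⁿ` is determined by its joint distribution function. -/
theorem ext_of_measureReal_forall_le {n : ℕ} (μ ν : Measure (Fin n → ℝ)) [IsProbabilityMeasure μ]
    [IsProbabilityMeasure ν]
    (h : ∀ x : Fin n → ℝ, μ.real {y | ∀ i, y i ≤ x i} = ν.real {y | ∀ i, y i ≤ x i}) : μ = ν := by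
  have hspan : IsCountablySpanning (Set.range (Set.Iic : ℝ → Set ℝ)) := by
    refine ⟨fun k : ℕ => Set.Iic (k : ℝ), fun k => ⟨k, rfl⟩, ?_⟩
    ext x
    simpa using exists_nat_ge x
  refine ext_of_generate_finite (Set.pi Set.univ '' Set.pi Set.univ
    fun _ : Fin n => Set.range (Set.Iic : ℝ → Set ℝ)) ?_ (IsPiSystem.pi fun _ => isPiSystem_Iic) ?_
    (by simp)
  · refine (generateFrom_eq_pi (fun _ => ?_) fun _ => hspan).symm
    rw [← borel_eq_generateFrom_Iic, BorelSpace.measurable_eq (α := ℝ)]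
  · rintro _ ⟨s, hs, rfl⟩
    choose x hx using fun i => hs i (Set.mem_univ i)
    have hset : Set.pi Set.univ s = {y | ∀ i, y i ≤ x i} := by
      ext y
      simp [← hx]
    rw [hset, ← ofReal_measureReal, ← ofReal_measureReal, h]

theorem IsJointLaw.eq {n : ℕ} {C : (Fin n → ℝ) → ℝ} {F : Fin n → Measure ℝ}
    {μ ν : Measure (Fin n → ℝ)} (hμ : IsJointLaw C F μ) (hν : IsJointLaw C F ν) : μ = ν := by
  have := hμ.1
  have := hν.1
  exact ext_of_measureReal_forall_le μ ν fun x => by rw [hμ.2.2, hν.2.2]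

theorem map_rescale_uniformLaw {a : ℝ} (ha : 0 < a) :
    (uniformLaw (-a) a).map (fun y => (y + a) / (2 * a)) = uniformLaw 0 1 := by
  have hf : (fun y => (y + a) / (2 * a)) = fun y => (2 * a)⁻¹ * y + 1 / 2 := by
    ext y; field_simp
  have h := map_affine_restrict (c := (2 * a)⁻¹) (d := 1 / 2) (by positivity)
    (S := Set.Icc (-a) a) (S' := Set.Icc 0 1) measurableSet_Icc (fun x => by
      rw [← congrFun hf x, Set.mem_Icc, Set.mem_Icc, div_le_one (by positivity),
        le_div_iff₀ (by positivity)]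
      constructor <;> rintro ⟨h1, h2⟩ <;> constructor <;> linarith)
  rw [uniformLaw_eq_smul (by linarith), uniformLaw_eq_smul one_pos, Measure.map_smul, hf, h,
    smul_smul, ← ENNReal.ofReal_mul (inv_nonneg.2 (by linarith))]
  congr 2
  rw [inv_inv, abs_of_pos (by positivity)]
  field_simp
  norm_num

theorem cdf_uniformLaw {a x : ℝ} (ha : 0 < a) (hx : x ∈ Set.Icc (-a) a) :
    cdf (uniformLaw (-a) a) x = (x + a) / (2 * a) := by
  have := isProbabilityMeasure_uniformLaw (a := -a) (b := a) (by linarith)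
  have hset : Set.Iic x ∩ Set.Icc (-a) a = Set.Icc (-a) x := by
    ext y
    simp only [Set.mem_inter_iff, Set.mem_Iic, Set.mem_Icc]
    exact ⟨fun h => ⟨h.2.1, h.1⟩, fun h => ⟨h.2, h.1, h.2.trans hx.2⟩⟩
  rw [cdf_eq_real, uniformLaw_eq_smul (by linarith), measureReal_def, Measure.smul_apply,
    Measure.restrict_apply' measurableSet_Icc, hset, Real.volume_Icc, smul_eq_mul,
    ← ENNReal.ofReal_mul (inv_nonneg.2 (by linarith)),
    ENNReal.toReal_ofReal (mul_nonneg (inv_nonneg.2 (by linarith)) (by linarith [hx.1]))]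
  field_simp
  ring

theorem rescale_le_cdf_uniformLaw_iff {a x y : ℝ} (ha : 0 < a) (hy : y ∈ Set.Ioo (-a) a) :
    (y + a) / (2 * a) ≤ cdf (uniformLaw (-a) a) x ↔ y ≤ x := by
  rw [div_le_iff₀ (by positivity)]
  rcases lt_or_ge x (-a) with h | h
  · have h1 := monotone_cdf (uniformLaw (-a) a) h.le
    rw [cdf_uniformLaw ha ⟨le_rfl, by linarith⟩, neg_add_cancel, zero_div] at h1
    constructor <;> intro h2
    · nlinarith [hy.1]
    · linarith [hy.1]
  · rcases le_or_gt x a with h' | h'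
    · rw [cdf_uniformLaw ha ⟨h, h'⟩, div_mul_cancel₀ _ (by positivity)]
      constructor <;> intro <;> linarith
    · have h1 := monotone_cdf (uniformLaw (-a) a) h'.le
      rw [cdf_uniformLaw ha ⟨by linarith, le_rfl⟩, ← two_mul, div_self (by positivity)] at h1
      constructor <;> intro h2
      · linarith [hy.2]
      · nlinarith [hy.2]

/-- The easy half of Sklar's theorem for uniform margins: a copula is obtained by rescaling. -/
theorem exists_copula {n : ℕ} {a : ℝ} (ha : 0 < a) (μ : Measure (Fin n → ℝ))
    [IsProbabilityMeasure μ] (hμ : ∀ i, μ.map (fun x => x i) = uniformLaw (-a) a) :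
    ∃ C, IsCopula C ∧ IsJointLaw C (fun _ => uniformLaw (-a) a) μ := by
  have hR : Measurable fun (y : Fin n → ℝ) (i : Fin n) => (y i + a) / (2 * a) := by fun_prop
  set ν := μ.map fun (y : Fin n → ℝ) (i : Fin n) => (y i + a) / (2 * a) with hν
  refine ⟨fun u => ν.real {x | ∀ i, x i ≤ u i}, ⟨ν, Measure.isProbabilityMeasure_map
    hR.aemeasurable, fun i => ?_, fun u _ => rfl⟩, inferInstance, hμ, fun x => ?_⟩
  · rw [hν, Measure.map_map (by fun_prop) hR, ← map_rescale_uniformLaw ha, ← hμ i,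
      Measure.map_map (by fun_prop) (by fun_prop)]
    rfl
  · have hms : MeasurableSet
        {y : Fin n → ℝ | ∀ i, y i ≤ cdf (uniformLaw (-a) a) (x i)} := by
      rw [Set.ofPred_forall]
      exact MeasurableSet.iInter fun i => measurableSet_le (by fun_prop) measurable_const
    dsimp only
    rw [hν, map_measureReal_apply hR hms]
    refine measureReal_congr (Filter.eventuallyEq_set.2 ?_)
    have hae : ∀ᵐ y ∂μ, ∀ i, y i ∈ Set.Ioo (-a) a := by
      refine ae_all_iff.2 fun i => ae_of_ae_map
        (f := fun y : Fin n → ℝ => y i) (p := fun t : ℝ => t ∈ Set.Ioo (-a) a)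
        (measurable_pi_apply i).aemeasurable ?_
      rw [hμ i, uniformLaw_eq_smul (by linarith), ← Measure.restrict_congr_set Ioo_ae_eq_Icc]
      exact Measure.ae_smul_measure (ae_restrict_mem measurableSet_Ioo) _
    filter_upwards [hae] with y hy
    exact forall_congr' fun i => (rescale_le_cdf_uniformLaw_iff ha (hy i)).symm

/-! ### The construction -/

theorem mainTheorem3 (n : ℕ) (hn : 2 ≤ n) :
    ∃ (C : (Fin n → ℝ) → ℝ) (a : ℝ), IsCopula C ∧ 0 < a ∧
      (∃ μ : Measure (Fin n → ℝ), IsJointLaw C (fun _ => uniformLaw (-a) a) μ) ∧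
      ∀ μ : Measure (Fin n → ℝ), IsJointLaw C (fun _ => uniformLaw (-a) a) μ →
        EmpiricallyIndistinguishable (μ.map fun x => ∑ i, x i) (gaussianReal 0 1) := by
  have : NullSingletonClass (gaussianReal 0 1) := nullSingletonClass_gaussianReal one_ne_zero
  have hδ : min (medL2W (gaussianReal 0 1) (10 ^ 6)) (medKS (gaussianReal 0 1) (10 ^ 6)) ≠ 0 :=
    (lt_min (medL2W_pos _ (by positivity)) (medKS_pos _ (by positivity))).ne'
  obtain ⟨a, P, X, Y, Z, ha, hP, hX, hY, hZ, hXu, hYu, hZg, hks, hW⟩ := exists_uniform_coupling hδ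
  obtain ⟨f, i₀, hf₀, hfm, hfu, hf⟩ := exists_jointMix ha n hn
  -- In the mix `f i (Y)`, whose sum is zero, the component `f i₀ (Y) = Y` is replaced by `X`.
  set V : ℝ × ℝ → Fin n → ℝ := fun q i => if i = i₀ then X q else f i (Y q) with hV
  have hVi : ∀ i, Measurable fun q => V q i := fun i => by
    by_cases h : i = i₀
    · simpa [hV, h] using hX
    · simpa [hV, h, Function.comp_def] using (hfm i).comp hY
  have hVm : Measurable V := measurable_pi_iff.2 hVi
  have hsum : ∀ q, ∑ i, V q i = X q - Y q := fun q => by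
    have h := hf (Y q)
    rw [← Finset.add_sum_erase _ _ (Finset.mem_univ i₀), hf₀] at h
    have hrest : ∑ i ∈ Finset.univ.erase i₀, V q i = ∑ i ∈ Finset.univ.erase i₀, f i (Y q) :=
      Finset.sum_congr rfl fun i hi => if_neg (Finset.ne_of_mem_erase hi)
    have hmain : V q i₀ = X q := if_pos rfl
    rw [← Finset.add_sum_erase _ _ (Finset.mem_univ i₀), hrest, hmain]
    linarith
  have hmargin : ∀ i, (P.map V).map (fun x => x i) = uniformLaw (-a) a := fun i => by
    rw [Measure.map_map (measurable_pi_apply i) hVm]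
    by_cases h : i = i₀
    · rw [← hXu]; congr 1; ext q; simp [hV, h]
    · rw [← hfu i, ← hYu, Measure.map_map (hfm i) hY]; congr 1; ext q; simp [hV, h]
  have := Measure.isProbabilityMeasure_map (μ := P) hVm.aemeasurable
  obtain ⟨C, hC, hJ⟩ := exists_copula ha (P.map V) hmargin
  refine ⟨C, a, hC, ha, ⟨P.map V, hJ⟩, fun μ hμ => ?_⟩
  rw [hμ.eq hJ, Measure.map_map (by fun_prop) hVm,
    show (fun x : Fin n → ℝ => ∑ i, x i) ∘ V = fun q => X q - Y q from funext hsum]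
  constructor
  · refine le_trans ?_ (hW.trans (min_le_left _ _))
    rw [← hZg]
    exact l2WassersteinSq_cdf_map_le P (hX.sub hY) hZ
  · refine le_trans ?_ (hks.trans (min_le_right _ _))
    rw [← hZg]
    exact ksDist_cdf_map_le P (hX.sub hY) hZ
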